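/- Let $d\ge 0$ be an integer, let $\mathbb R^d$ carry the Euclidean norm, and let ${\rm CO}(\mathbb R^d)$ be the set of all closed convex subsets of $\mathbb R^d$ (including $\emptyset$), ordered by inclusion. It is a complete lattice with $\inf_\alpha A_\alpha=\bigcap_\alpha A_\alpha$ and $\sup_\alpha A_\alpha=\overline{\rm conv}\big(\bigcup_\alpha A_\alpha\big)$. Equip it with the extended Wijsman topology, i.e. the smallest topology for which the maps $A\mapsto d(x,A)=\inf_{y\in A}\|x-y\|\in[0,\infty]$, $x\in\mathbb R^d$, are continuous, where $d(x,\emptyset)=\infty$, and with the Borel $\sigma$-algebra $\mathcal S$ of this topology. Then, with $S={\rm CO}(\mathbb R^d)$: (A1) the set $\{(A,B)\in S^2: A\subseteq B\}$ lies in the product $\sigma$-algebra $\mathcal S\otimes\mathcal S$; (A2) the maps $(A_1,A_2,\ldots)\mapsto\sup_n A_n$ and $(A_1,A_2,\ldots)\mapsto\inf_n A_n$ from $S^\infty$, with the product $\sigma$-algebra, to $S$ are measurable; (A3) there exists a measurable map $\phi\colon S\to\mathbb R$ that is strictly increasing, i.e. $A\subsetneq B$ implies $\phi(A)<\phi(B)$.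 Moreover, let $\mu$ be the standard Gaussian distribution on $\mathbb R^d$. For every nonempty affine subspace $V\subseteq\mathbb R^d$ there is a law $\mu(\,\cdot\mid V)$ of a standard Gaussian vector conditioned to lie in $V$, namely the probability measure that is the weak limit, as $\varepsilon\downarrow0$, of the conditional laws $\mu(\,\cdot\,\cap V_\varepsilon)/\mu(V_\varepsilon)$, where $V_\varepsilon=\{x: d(x,V)\le\varepsilon\}$; and a strictly increasing measurable map $\phi\colon S\to\mathbb R$ is given by \[ \phi(A)=\dim({\rm aff}\,A)+\mu(A\mid{\rm aff}\,A), \] with the conventions $\dim(\emptyset)=-1$ and $\mu(\emptyset\mid\emptyset)=0$. -/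

import Mathlib

open MeasureTheory ProbabilityTheory Filter Topology
open scoped BoundedContinuousFunction

noncomputable section

namespace ConvexLattice

/-! ### Measurable complete lattices -/

/-- The triangle `{(x, y) | x ≤ y}` lies in the product σ-algebra. -/
def A1 (S : Type*) [CompleteLattice S] [MeasurableSpace S] : Prop :=
  MeasurableSet {p : S × S | p.1 ≤ p.2}

/-- The countable supremum and infimum maps are measurable, for the product σ-algebra on the
set of sequences. -/
def A2 (S : Type*) [CompleteLattice S] [MeasurableSpace S] : Prop :=
  Measurable (fun x : ℕ → S => ⨆ n, x n) ∧ Measurable (fun x : ℕ → S => ⨅ n, x n)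

/-- There is a strictly increasing measurable real-valued map. -/
def A3 (S : Type*) [CompleteLattice S] [MeasurableSpace S] : Prop :=
  ∃ φ : S → ℝ, StrictMono φ ∧ Measurable φ

/-! ### Closed subsets of a metric space and the extended Wijsman topology -/

/-- The closed subsets of `X`, the empty set included. -/
@[ext]
structure CL0 (X : Type*) [MetricSpace X] where
  carrier : Set X
  isClosed : IsClosed carrier

/-- The extended Wijsman topology: the smallest topology for which all the distance maps
`A ↦ d(x, A) ∈ [0, ∞]` are continuous, where `d(x, ∅) = ∞`. So `A i → A` if and only if
`d(x, A i) → d(x, A)` for all `x`; in particular `A i → ∅` if and only if `d(x, A i) → ∞`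
for all `x`, and on nonempty closed sets this is the usual Wijsman topology. -/
instance (X : Type*) [MetricSpace X] : TopologicalSpace (CL0 X) :=
  ⨅ x : X, TopologicalSpace.induced (fun A => Metric.infEDist x A.carrier) inferInstance

/-! ### Closed convex subsets of Euclidean space -/

/-- `ℝ^d` with the Euclidean norm. -/
abbrev E (d : ℕ) : Type := EuclideanSpace ℝ (Fin d)

/-- The closed convex subsets of `ℝ^d`, the empty set included. -/
@[ext]
structure CO (d : ℕ) extends CL0 (E d) where
  convex : Convex ℝ carrier

theorem CO.carrier_injective (d : ℕ) : Function.Injective (fun A : CO d => A.carrier) := by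
  intro A B h
  exact CO.ext h

/-- The subspace topology. -/
instance (d : ℕ) : TopologicalSpace (CO d) :=
  TopologicalSpace.induced CO.toCL0 inferInstance

/-- The Borel σ-algebra. -/
instance (d : ℕ) : MeasurableSpace (CO d) := borel (CO d)

/-- The order is set inclusion. -/
instance (d : ℕ) : PartialOrder (CO d) :=
  PartialOrder.lift (fun A => A.carrier) (CO.carrier_injective d)

/-- The closed convex hull of a set, as an element of the lattice. -/
def CO.hull {d : ℕ} (s : Set (E d)) : CO d where
  carrier := closure (convexHull ℝ s)
  isClosed := isClosed_closure
  convex := (convex_convexHull ℝ s).closure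

theorem CO.hull_le {d : ℕ} {s : Set (E d)} {B : CO d} (h : s ⊆ B.carrier) : CO.hull s ≤ B :=
  closure_minimal (convexHull_min h B.convex) B.isClosed

theorem CO.subset_hull {d : ℕ} (s : Set (E d)) : s ⊆ (CO.hull s).carrier :=
  (subset_convexHull ℝ s).trans subset_closure

/-- Suprema are closed convex hulls of unions, infima are intersections. -/
instance (d : ℕ) : CompleteLattice (CO d) where
  sup A B := CO.hull (A.carrier ∪ B.carrier)
  le_sup_left _ _ := Set.subset_union_left.trans (CO.subset_hull _)
  le_sup_right _ _ := Set.subset_union_right.trans (CO.subset_hull _)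
  sup_le _ _ _ h₁ h₂ := CO.hull_le (Set.union_subset h₁ h₂)
  inf A B := ⟨⟨A.carrier ∩ B.carrier, A.isClosed.inter B.isClosed⟩, A.convex.inter B.convex⟩
  inf_le_left _ _ := Set.inter_subset_left
  inf_le_right _ _ := Set.inter_subset_right
  le_inf _ _ _ h₁ h₂ := Set.subset_inter h₁ h₂
  sSup 𝒜 := CO.hull (⋃ A ∈ 𝒜, A.carrier)
  isLUB_sSup 𝒜 :=
    ⟨fun _ hA => (Set.subset_biUnion_of_mem (u := fun A : CO d => A.carrier) hA).trans
      (CO.subset_hull _), fun _ hB => CO.hull_le (Set.iUnion₂_subset fun _ hA => hB hA)⟩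
  sInf 𝒜 := ⟨⟨⋂ A ∈ 𝒜, A.carrier, isClosed_biInter fun A _ => A.isClosed⟩,
    convex_iInter₂ fun A _ => A.convex⟩
  isGLB_sInf 𝒜 :=
    ⟨fun _ hA => Set.biInter_subset_of_mem (t := fun A : CO d => A.carrier) hA,
      fun _ hB => Set.subset_iInter₂ fun _ hA => hB hA⟩
  top := ⟨⟨Set.univ, isClosed_univ⟩, convex_univ⟩
  le_top _ := Set.subset_univ _
  bot := ⟨⟨∅, isClosed_empty⟩, convex_empty⟩
  bot_le _ := Set.empty_subset _

/-! ### The map `φ` -/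

/-- The dimension of an affine subspace, with the convention `dim ∅ = -1`. -/
def affDim {d : ℕ} (V : AffineSubspace ℝ (E d)) : ℤ :=
  open scoped Classical in
  if (V : Set (E d)) = ∅ then -1 else (Module.finrank ℝ V.direction : ℤ)

/-- `ν` is the law of a standard Gaussian vector of `ℝ^d` conditioned to lie in `V`: the
probability measure that is the weak limit, as `ε ↓ 0`, of the elementary conditional laws
`μ(· ∩ V_ε) / μ(V_ε)`, where `V_ε = {x | d(x, V) ≤ ε}`. -/
def IsGaussianGiven {d : ℕ} (V : AffineSubspace ℝ (E d)) (ν : Measure (E d)) : Prop :=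
  IsProbabilityMeasure ν ∧
    ∀ f : E d →ᵇ ℝ,
      Tendsto (fun ε : ℝ => ∫ x, f x ∂((stdGaussian (E d))[|Metric.cthickening ε (V : Set (E d))]))
        (𝓝[>] 0) (𝓝 (∫ x, f x ∂ν))

/-- `μ(· | V)`, the standard Gaussian distribution conditioned on the affine subspace `V`
(the zero measure for `V = ∅`). -/
def gaussianGiven {d : ℕ} (V : AffineSubspace ℝ (E d)) : Measure (E d) :=
  open scoped Classical in
  if h : ∃ ν, IsGaussianGiven V ν then h.choose else 0

/-- `φ(A) = dim (aff A) + μ(A | aff A)`. -/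
def phi {d : ℕ} (A : CO d) : ℝ :=
  (affDim (affineSpan ℝ A.carrier) : ℝ) +
    (gaussianGiven (affineSpan ℝ A.carrier)).real A.carrier

end ConvexLattice

end

/-!
A map into `CO d` is measurable exactly when, for every open set `O`, the parameters at which its
value hits `O` form a measurable set. Convex hulls and affine spans inherit this property because
they are unions of continuous images of finite powers of the set, and intersections of closed sets
inherit it by compactness.

The components of a standard Gaussian vector along `V` and orthogonal to `V` are independent, so
`μ(· | V)` is the law of the orthogonal projection to `V`. It charges every convex set whose affine
hull is `V`. If `A ⊊ B` have the same affine hull, then a small ball around a point of `B \ A` meets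
`B` in a convex set with that same affine hull, so `φ` increases through its Gaussian part;
otherwise the dimension jumps by at least `1`, while the Gaussian part of `φ` is at most `1` and is
positive on nonempty sets. Measurability of the Gaussian part holds because the projection of `x` to
`aff A` lies in `A` if and only if `d(x, A) ≤ d(x, aff A)`.
-/

noncomputable section

namespace ConvexLattice

open Metric

/-! ### Weakly measurable set-valued maps -/

section WeaklyMeasurable

variable {T X Y : Type*} [MeasurableSpace T]

/-- Weak (or Effros) measurability of a set-valued map: for every open set, the parameters whose
value hits it form a measurable set. -/
def WeaklyMeasurable [TopologicalSpace X] (B : T → Set X) : Prop :=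
  ∀ ⦃O : Set X⦄, IsOpen O → MeasurableSet {t | (B t ∩ O).Nonempty}

namespace WeaklyMeasurable

section Topological

variable [TopologicalSpace X] [TopologicalSpace Y] {B : T → Set X}

theorem comp {T' : Type*} [MeasurableSpace T'] (hB : WeaklyMeasurable B) {g : T' → T}
    (hg : Measurable g) : WeaklyMeasurable fun t => B (g t) :=
  fun _ hO => hg (hB hO)

theorem closure (hB : WeaklyMeasurable B) : WeaklyMeasurable fun t => closure (B t) := by
  intro O hO
  simpa only [closure_inter_open_nonempty_iff hO] using hB hO

theorem iUnion {ι : Type*} [Countable ι] {B : ι → T → Set X} (hB : ∀ i, WeaklyMeasurable (B i)) :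
    WeaklyMeasurable fun t => ⋃ i, B i t := by
  intro O hO
  simp only [Set.iUnion_inter, Set.nonempty_iUnion, Set.ofPred_exists]
  exact .iUnion fun i => hB i hO

theorem iUnion_image {ι : Type*} {f : ι → X → Y} (hB : WeaklyMeasurable B)
    (hf : ∀ i, Continuous (f i)) : WeaklyMeasurable fun t => ⋃ i, f i '' B t := by
  intro O hO
  convert hB (isOpen_iUnion fun i => hO.preimage (hf i)) using 3 with t
  simp only [Set.iUnion_inter, Set.inter_iUnion, Set.nonempty_iUnion,
    Set.image_inter_nonempty_iff]

theorem of_isTopologicalBasis [SecondCountableTopology X] {𝒰 : Set (Set X)}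
    (h𝒰 : TopologicalSpace.IsTopologicalBasis 𝒰)
    (hB : ∀ U ∈ 𝒰, MeasurableSet {t | (B t ∩ U).Nonempty}) : WeaklyMeasurable B := by
  intro O hO
  obtain ⟨𝒱, h𝒱, rfl⟩ := h𝒰.open_eq_sUnion hO
  obtain ⟨𝒲, h𝒲, h𝒲𝒱, hUnion⟩ :=
    TopologicalSpace.isOpen_sUnion_countable 𝒱 fun U hU => h𝒰.isOpen (h𝒱 hU)
  have hset : {t | (B t ∩ ⋃₀ 𝒱).Nonempty} = ⋃ U ∈ 𝒲, {t | (B t ∩ U).Nonempty} := by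
    ext t
    simp only [← hUnion, Set.sUnion_eq_biUnion, Set.inter_iUnion, Set.nonempty_iUnion,
      Set.mem_ofPred_eq, Set.mem_iUnion]
  rw [hset]
  exact .biUnion h𝒲 fun U hU => hB U (h𝒱 (h𝒲𝒱 hU))

theorem pi {ι : Type*} [Finite ι] {X : ι → Type*} [∀ i, TopologicalSpace (X i)]
    [∀ i, SecondCountableTopology (X i)] {B : ∀ i, T → Set (X i)}
    (hB : ∀ i, WeaklyMeasurable (B i)) :
    WeaklyMeasurable fun t => Set.univ.pi fun i => B i t := by
  have hbasis : TopologicalSpace.IsTopologicalBasis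
      {S : Set (∀ i, X i) | ∃ U : ∀ i, Set (X i), (∀ i, IsOpen (U i)) ∧ S = Set.univ.pi U} := by
    refine TopologicalSpace.isTopologicalBasis_of_isOpen_of_nhds ?_ fun a O ha hO => ?_
    · rintro _ ⟨U, hU, rfl⟩
      exact isOpen_set_pi Set.finite_univ fun i _ => hU i
    · obtain ⟨U, hU, hUO⟩ := isOpen_pi_iff'.1 hO a ha
      exact ⟨_, ⟨U, fun i => (hU i).1, rfl⟩, fun i _ => (hU i).2, hUO⟩
  refine of_isTopologicalBasis hbasis ?_
  rintro _ ⟨U, hU, rfl⟩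
  simp only [← Set.pi_inter_distrib, Set.univ_pi_nonempty_iff, Set.ofPred_forall]
  exact .iInter fun i => hB i (hU i)

end Topological

end WeaklyMeasurable

section LinearCombinations

variable [AddCommGroup X] [Module ℝ X]

theorem convexHull_eq_iUnion_image_pi (s : Set X) :
    convexHull ℝ s = ⋃ k : ℕ, ⋃ w : stdSimplex ℝ (Fin k),
      (fun y : Fin k → X => ∑ i, (w : Fin k → ℝ) i • y i) '' Set.univ.pi fun _ => s := by
  ext z
  simp only [Set.mem_iUnion, Set.mem_image, Set.mem_univ_pi]
  constructor
  · intro hz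
    obtain ⟨ι, _, w, y, hw, hw1, hy, rfl⟩ := mem_convexHull_iff_exists_fintype.1 hz
    let e := (Fintype.equivFin ι).symm
    exact ⟨Fintype.card ι, ⟨w ∘ e, fun i => hw _, (e.sum_comp w).trans hw1⟩, y ∘ e,
      fun i => hy _, e.sum_comp fun i => w i • y i⟩
  · rintro ⟨k, ⟨w, hw, hw1⟩, y, hy, rfl⟩
    exact mem_convexHull_of_exists_fintype w y hw hw1 hy rfl

theorem affineSpan_eq_iUnion_image_pi (s : Set X) :
    (affineSpan ℝ s : Set X) = ⋃ k : ℕ, ⋃ w : {w : Fin k → ℝ // ∑ i, w i = 1},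
      (fun y : Fin k → X => ∑ i, (w : Fin k → ℝ) i • y i) '' Set.univ.pi fun _ => s := by
  ext z
  simp only [Set.mem_iUnion, Set.mem_image, Set.mem_univ_pi]
  constructor
  · intro hz
    rw [SetLike.mem_coe, ← Subtype.range_coe (s := s)] at hz
    obtain ⟨t, w, hw, rfl⟩ := eq_affineCombination_of_mem_affineSpan hz
    let e := t.equivFin.symm
    refine ⟨t.card, ⟨fun i => w (e i), ?_⟩, fun i => (e i : s), fun i => (e i : s).2, ?_⟩
    · rw [e.sum_comp fun i : t => w i, Finset.sum_coe_sort t w, hw]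
    · rw [Finset.affineCombination_eq_linear_combination _ _ _ hw,
        e.sum_comp fun i : t => w i • (i : X), Finset.sum_coe_sort t fun i => w i • (i : X)]
  · rintro ⟨k, ⟨w, hw⟩, y, hy, rfl⟩
    rw [← Finset.affineCombination_eq_linear_combination _ _ _ hw]
    exact affineSpan_mono ℝ (Set.range_subset_iff.2 hy) (affineCombination_mem_affineSpan hw y)

variable [TopologicalSpace X] [ContinuousAdd X] [ContinuousSMul ℝ X] [SecondCountableTopology X]
  {B : T → Set X}

theorem WeaklyMeasurable.convexHull (hB : WeaklyMeasurable B) :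
    WeaklyMeasurable fun t => convexHull ℝ (B t) := by
  simp_rw [convexHull_eq_iUnion_image_pi]
  exact .iUnion fun k => .iUnion_image (.pi fun _ => hB) fun w => by fun_prop

theorem WeaklyMeasurable.affineSpan (hB : WeaklyMeasurable B) :
    WeaklyMeasurable fun t => (affineSpan ℝ (B t) : Set X) := by
  simp_rw [affineSpan_eq_iUnion_image_pi]
  exact .iUnion fun k => .iUnion_image (.pi fun _ => hB) fun w => by fun_prop

end LinearCombinations

section InfEDist

variable [PseudoEMetricSpace X]

theorem subset_iff_infEDist_le {s t : Set X} (ht : IsClosed t) :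
    s ⊆ t ↔ ∀ x, infEDist x t ≤ infEDist x s := by
  refine ⟨fun h x => infEDist_anti h, fun h x hx => ?_⟩
  rw [mem_iff_infEDist_zero_of_closed ht, ← nonpos_iff_eq_zero]
  exact (h x).trans_eq (infEDist_zero_of_mem hx)

theorem inter_iInter_nonempty_iff_infEDist_lt {K D : Set X}
    (hK : IsCompact K) (hDK : D ⊆ K) (hKD : K ⊆ closure D) {C : ℕ → Set X}
    (hC : ∀ n, IsClosed (C n)) :
    (K ∩ ⋂ n, C n).Nonempty ↔
      ∀ m : ℕ, ∃ x ∈ D, ∀ n ≤ m, infEDist x (C n) < (m + 1 : ENNReal)⁻¹ := by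
  constructor
  · rintro ⟨y, hyK, hyC⟩ m
    obtain ⟨x, hxD, hyx⟩ := EMetric.mem_closure_iff.1 (hKD hyK) (m + 1 : ENNReal)⁻¹
      (ENNReal.inv_pos.2 (by finiteness))
    rw [edist_comm] at hyx
    exact ⟨x, hxD, fun n _ => (infEDist_le_edist_of_mem (Set.mem_iInter.1 hyC n)).trans_lt hyx⟩
  · intro h
    have hclosed : ∀ m : ℕ, IsClosed {x | ∀ n ≤ m, infEDist x (C n) ≤ (m + 1 : ENNReal)⁻¹} := by
      intro m
      simp only [Set.ofPred_forall]
      exact isClosed_iInter fun n => isClosed_iInter fun _ =>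
        isClosed_le continuous_infEDist continuous_const
    obtain ⟨a, haK, ha⟩ := hK.inter_iInter_nonempty _ hclosed fun u => by
      obtain ⟨x, hxD, hx⟩ := h (u.sup id)
      refine ⟨x, hDK hxD, Set.mem_iInter₂.2 fun m hm n hn => ?_⟩
      have hmu : m ≤ u.sup id := Finset.le_sup (f := id) hm
      exact (hx n (hn.trans hmu)).le.trans (by gcongr)
    refine ⟨a, haK, Set.mem_iInter.2 fun n => ?_⟩
    rw [mem_iff_infEDist_zero_of_closed (hC n), ← nonpos_iff_eq_zero]
    have hlim : Tendsto (fun m : ℕ => (m + 1 : ENNReal)⁻¹) atTop (𝓝 0) := by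
      simpa only [Function.comp_def, Nat.cast_add_one] using
        ENNReal.tendsto_inv_nat_nhds_zero.comp (tendsto_add_atTop_nat 1)
    exact ge_of_tendsto hlim ((eventually_ge_atTop n).mono fun m hm => Set.mem_iInter.1 ha m n hm)

variable {B C : T → Set X}

theorem WeaklyMeasurable.measurable_infEDist (hB : WeaklyMeasurable B) (x : X) :
    Measurable fun t => infEDist x (B t) := by
  refine measurable_of_Iio fun r => ?_
  convert hB (isOpen_eball (x := x) (ε := r)) using 1
  ext t
  simp only [Set.mem_preimage, Set.mem_Iio, infEDist_lt_iff, edist_comm x]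
  rfl

variable [SecondCountableTopology X]

theorem weaklyMeasurable_iff_infEDist :
    WeaklyMeasurable B ↔ ∀ x, Measurable fun t => infEDist x (B t) := by
  refine ⟨fun hB x => hB.measurable_infEDist x, fun h => ?_⟩
  have hbasis : TopologicalSpace.IsTopologicalBasis
      {U : Set X | ∃ x r, U = eball x r} := by
    refine TopologicalSpace.isTopologicalBasis_of_isOpen_of_nhds ?_ fun x O hx hO => ?_
    · rintro _ ⟨x, r, rfl⟩
      exact isOpen_eball
    · obtain ⟨r, hr, hrO⟩ := EMetric.isOpen_iff.1 hO x hx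
      exact ⟨_, ⟨x, r, rfl⟩, mem_eball_self hr, hrO⟩
  refine .of_isTopologicalBasis hbasis ?_
  rintro _ ⟨x, r, rfl⟩
  convert measurableSet_lt (h x) (measurable_const (a := r)) using 1
  ext t
  simp only [Set.mem_ofPred_eq, infEDist_lt_iff, edist_comm x]
  rfl

theorem WeaklyMeasurable.measurableSet_subset (hB : WeaklyMeasurable B) (hC : WeaklyMeasurable C)
    (hCc : ∀ t, IsClosed (C t)) : MeasurableSet {t | B t ⊆ C t} := by
  obtain ⟨D, hD, hdense⟩ := TopologicalSpace.exists_countable_dense X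
  have hset : {t | B t ⊆ C t} = ⋂ x ∈ D, {t | infEDist x (C t) ≤ infEDist x (B t)} := by
    ext t
    simp only [Set.mem_ofPred_eq, Set.mem_iInter, subset_iff_infEDist_le (hCc t)]
    refine ⟨fun h x _ => h x, fun h => isClosed_property hdense.denseRange_val
      (isClosed_le continuous_infEDist continuous_infEDist) fun x => h x x.2⟩
  rw [hset]
  exact .biInter hD fun x _ =>
    measurableSet_le (hC.measurable_infEDist x) (hB.measurable_infEDist x)

end InfEDist

section Metric

theorem WeaklyMeasurable.measurable_infEDist_prod [MetricSpace X] [SecondCountableTopology X]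
    [MeasurableSpace X] [OpensMeasurableSpace X] {B : T → Set X} (hB : WeaklyMeasurable B) :
    Measurable fun p : T × X => infEDist p.2 (B p.1) :=
  (measurable_uncurry_of_continuous_of_measurable (u := fun x t => infEDist x (B t))
    (fun _ => continuous_infEDist) hB.measurable_infEDist).comp measurable_swap

variable [PseudoMetricSpace X] {C : ℕ → T → Set X}

theorem WeaklyMeasurable.measurableSet_inter_iInter_nonempty (hC : ∀ n, WeaklyMeasurable (C n))
    (hCc : ∀ n t, IsClosed (C n t)) {K : Set X} (hK : IsCompact K) :
    MeasurableSet {t | (K ∩ ⋂ n, C n t).Nonempty} := by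
  obtain ⟨D, hDK, hD, hKD⟩ := hK.isSeparable.exists_countable_dense_subset
  simp only [inter_iInter_nonempty_iff_infEDist_lt hK hDK hKD fun n => hCc n _, Set.ofPred_forall]
  refine .iInter fun m => ?_
  have hset : {t | ∃ x ∈ D, ∀ n ≤ m, infEDist x (C n t) < (m + 1 : ENNReal)⁻¹} =
      ⋃ x ∈ D, ⋂ n ≤ m, {t | infEDist x (C n t) < (m + 1 : ENNReal)⁻¹} := by
    ext t
    simp only [Set.mem_ofPred_eq, Set.mem_iUnion, Set.mem_iInter, exists_prop]
  rw [hset]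
  exact .biUnion hD fun x _ => .iInter fun n => .iInter fun _ =>
    measurableSet_lt ((hC n).measurable_infEDist x) measurable_const

theorem WeaklyMeasurable.iInter [SigmaCompactSpace X] (hC : ∀ n, WeaklyMeasurable (C n))
    (hCc : ∀ n t, IsClosed (C n t)) : WeaklyMeasurable fun t => ⋂ n, C n t := by
  intro O hO
  obtain ⟨F, hF, -, hFO, -⟩ := hO.exists_iUnion_isClosed
  have hset : {t | ((⋂ n, C n t) ∩ O).Nonempty} =
      ⋃ k, ⋃ m, {t | ((compactCovering X k ∩ F m) ∩ ⋂ n, C n t).Nonempty} := by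
    ext t
    simp only [Set.mem_ofPred_eq, Set.mem_iUnion, ← Set.nonempty_iUnion, ← Set.iUnion_inter,
      ← Set.inter_iUnion, hFO, iUnion_compactCovering, Set.inter_univ, Set.inter_comm]
  rw [hset]
  exact .iUnion fun k => .iUnion fun m => measurableSet_inter_iInter_nonempty hC hCc
    ((isCompact_compactCovering X k).inter_right (hF m))

end Metric

end WeaklyMeasurable

/-! ### The extended Wijsman topology -/

section Wijsman

section DenseRange

variable {X ι : Type*} [PseudoEMetricSpace X] {q : ι → X}

theorem infEDist_lt_iff_of_denseRange (hq : DenseRange q) {x : X} {s : Set X} {r : ENNReal} :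
    infEDist x s < r ↔ ∃ i, infEDist (q i) s + edist (q i) x < r := by
  refine ⟨fun h => hq.exists_mem_open (s := {y | infEDist y s + edist y x < r})
    (isOpen_lt (continuous_infEDist.add (by fun_prop)) continuous_const)
    ⟨x, by simpa only [Set.mem_ofPred_eq, edist_self, add_zero] using h⟩, ?_⟩
  rintro ⟨i, hi⟩
  rw [edist_comm] at hi
  exact infEDist_le_infEDist_add_edist.trans_lt hi

theorem lt_infEDist_iff_of_denseRange (hq : DenseRange q) {x : X} {s : Set X} {r : ENNReal} :
    r < infEDist x s ↔ ∃ i, r + edist (q i) x < infEDist (q i) s := by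
  refine ⟨fun h => hq.exists_mem_open (s := {y | r + edist y x < infEDist y s})
    (isOpen_lt (by fun_prop) continuous_infEDist)
    ⟨x, by simpa only [Set.mem_ofPred_eq, edist_self, add_zero] using h⟩, ?_⟩
  rintro ⟨i, hi⟩
  exact lt_of_add_lt_add_right (hi.trans_le infEDist_le_infEDist_add_edist)

theorem continuous_infEDist_of_denseRange {Z : Type*} [TopologicalSpace Z] {B : Z → Set X}
    (hq : DenseRange q) (h : ∀ i, Continuous fun z => infEDist (q i) (B z)) (x : X) :
    Continuous fun z => infEDist x (B z) := by
  refine continuous_iff_lower_upperSemicontinuous.2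
    ⟨lowerSemicontinuous_iff_isOpen_preimage.2 fun r => ?_,
      upperSemicontinuous_iff_isOpen_preimage.2 fun r => ?_⟩
  · have hset : (fun z => infEDist x (B z)) ⁻¹' Set.Ioi r =
        ⋃ i, {z | r + edist (q i) x < infEDist (q i) (B z)} := by
      ext z
      rw [Set.mem_iUnion]
      exact lt_infEDist_iff_of_denseRange hq
    rw [hset]
    exact isOpen_iUnion fun i => isOpen_lt continuous_const (h i)
  · have hset : (fun z => infEDist x (B z)) ⁻¹' Set.Iio r =
        ⋃ i, {z | infEDist (q i) (B z) + edist (q i) x < r} := by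
      ext z
      rw [Set.mem_iUnion]
      exact infEDist_lt_iff_of_denseRange hq
    rw [hset]
    exact isOpen_iUnion fun i => isOpen_lt ((h i).add continuous_const) continuous_const

end DenseRange

theorem CL0.continuous_infEDist {X : Type*} [MetricSpace X] (x : X) :
    Continuous fun A : CL0 X => infEDist x A.carrier :=
  continuous_iInf_dom (i := x) continuous_induced_dom

theorem CL0.isInducing_infEDist {X ι : Type*} [MetricSpace X] {q : ι → X} (hq : DenseRange q) :
    IsInducing fun (A : CL0 X) i => infEDist (q i) A.carrier := by
  refine ⟨le_antisymm (continuous_pi fun i => CL0.continuous_infEDist (q i)).le_induced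
    (le_iInf fun x => ?_)⟩
  let : TopologicalSpace (CL0 X) :=
    .induced (fun (A : CL0 X) i => infEDist (q i) A.carrier) inferInstance
  exact (continuous_infEDist_of_denseRange hq
    (fun i => (continuous_apply i).comp continuous_induced_dom) x).le_induced

end Wijsman

section CO

variable {d : ℕ} {T : Type*} [MeasurableSpace T]

instance : BorelSpace (CO d) := ⟨rfl⟩

theorem CO.isInducing_toCL0 : IsInducing (CO.toCL0 : CO d → CL0 (E d)) := ⟨rfl⟩

theorem CO.measurable_iff {f : T → CO d} :
    Measurable f ↔ WeaklyMeasurable fun t => (f t).carrier := by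
  rw [weaklyMeasurable_iff_infEDist]
  refine ⟨fun hf x => ((CL0.continuous_infEDist x).comp
    CO.isInducing_toCL0.continuous).measurable.comp hf, fun h => ?_⟩
  have hind := (CL0.isInducing_infEDist (TopologicalSpace.denseRange_denseSeq (E d))).comp
    CO.isInducing_toCL0
  rw [BorelSpace.measurable_eq (α := CO d), hind.eq_induced,
    borel_comap, ← BorelSpace.measurable_eq]
  exact measurable_comap_iff.2 (measurable_pi_iff.2 fun n => h _)

theorem CO.weaklyMeasurable_carrier : WeaklyMeasurable fun A : CO d => A.carrier :=
  CO.measurable_iff.1 measurable_id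

theorem CO.iSup_carrier {ι : Type*} (A : ι → CO d) :
    (⨆ i, A i).carrier = closure (convexHull ℝ (⋃ i, (A i).carrier)) := by
  change closure (convexHull ℝ (⋃ B ∈ Set.range A, B.carrier)) = _
  rw [Set.biUnion_range]

theorem CO.iInf_carrier {ι : Type*} (A : ι → CO d) :
    (⨅ i, A i).carrier = ⋂ i, (A i).carrier := by
  change (⋂ B ∈ Set.range A, B.carrier) = _
  rw [Set.biInter_range]

theorem CO.measurableSet_le : MeasurableSet {p : CO d × CO d | p.1 ≤ p.2} :=
  (CO.weaklyMeasurable_carrier.comp measurable_fst).measurableSet_subset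
    (CO.weaklyMeasurable_carrier.comp measurable_snd) fun p => p.2.isClosed

theorem CO.measurable_iSup {ι : Type*} [Countable ι] :
    Measurable fun A : ι → CO d => ⨆ i, A i := by
  simp only [CO.measurable_iff, CO.iSup_carrier]
  exact (WeaklyMeasurable.iUnion fun i =>
    CO.weaklyMeasurable_carrier.comp (measurable_pi_apply i)).convexHull.closure

theorem CO.measurable_iInf : Measurable fun A : ℕ → CO d => ⨅ n, A n := by
  simp only [CO.measurable_iff, CO.iInf_carrier]
  exact .iInter (fun n => CO.weaklyMeasurable_carrier.comp (measurable_pi_apply n))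
    fun n A => (A n).isClosed

end CO

/-! ### The standard Gaussian distribution conditioned on an affine subspace -/

section OrthogonalProjection

variable {F : Type*} [NormedAddCommGroup F] [InnerProductSpace ℝ F] {V : AffineSubspace ℝ F}
  [Nonempty V] [V.direction.HasOrthogonalProjection]

variable (V) in
theorem continuous_orthogonalProjection_coe :
    Continuous fun x => (EuclideanGeometry.orthogonalProjection V x : F) :=
  continuous_subtype_val.comp (EuclideanGeometry.orthogonalProjection V).continuous

theorem orthogonalProjection_eq_add {v : F} (hv : v ∈ V) (x : F) :
    (EuclideanGeometry.orthogonalProjection V x : F) =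
      V.direction.starProjection x + V.directionᗮ.starProjection v := by
  rw [EuclideanGeometry.orthogonalProjection_apply_mem V hv,
    Submodule.starProjection_orthogonal_val]
  simp only [vsub_eq_sub, vadd_eq_add, map_sub, Submodule.coe_sub,
    Submodule.coe_orthogonalProjectionOnto_apply]
  abel

theorem mem_cthickening_iff_dist_orthogonalProjection_le {ε : ℝ} (hε : 0 ≤ ε) {x : F} :
    x ∈ cthickening ε (V : Set F) ↔
      dist x (EuclideanGeometry.orthogonalProjection V x) ≤ ε := by
  rw [cthickening_eq_preimage_infEDist, Set.mem_preimage, Set.mem_Iic,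
    ENNReal.le_ofReal_iff_toReal_le (infEDist_ne_top Set.Nonempty.of_subtype) hε,
    EuclideanGeometry.dist_orthogonalProjection_eq_infDist]
  rfl

theorem cthickening_eq_starProjection_preimage {v : F} (hv : v ∈ V) {ε : ℝ} (hε : 0 ≤ ε) :
    cthickening ε (V : Set F) =
      V.directionᗮ.starProjection ⁻¹' closedBall (V.directionᗮ.starProjection v) ε := by
  ext x
  rw [mem_cthickening_iff_dist_orthogonalProjection_le hε, orthogonalProjection_eq_add hv]
  nth_rw 1 [← V.direction.starProjection_add_starProjection_orthogonal x]
  rw [dist_add_left]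
  rfl

theorem orthogonalProjection_mem_iff_infDist_le [ProperSpace F] {A : Set F} (hA : IsClosed A)
    (hne : A.Nonempty) (hAV : A ⊆ V) {x : F} :
    (EuclideanGeometry.orthogonalProjection V x : F) ∈ A ↔ infDist x A ≤ infDist x V := by
  rw [← EuclideanGeometry.dist_orthogonalProjection_eq_infDist]
  refine ⟨fun h => infDist_le_dist_of_mem h, fun h => ?_⟩
  obtain ⟨y, hy, hxy⟩ := hA.exists_infDist_eq_dist hne x
  have hdist : dist x y = dist x (EuclideanGeometry.orthogonalProjection V x) := by
    refine le_antisymm (hxy ▸ h) ?_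
    rw [EuclideanGeometry.dist_orthogonalProjection_eq_infDist]
    exact infDist_le_dist_of_mem (hAV hy)
  rwa [(EuclideanGeometry.dist_orthogonalProjection_eq_dist_iff_eq_of_mem (hAV hy)).1 hdist.symm]

end OrthogonalProjection

section Gaussian

variable {X : Type*}

theorem map_cond_preimage_of_indepFun {Y Z : Type*} [MeasurableSpace X]
    [MeasurableSpace Y] [MeasurableSpace Z] {μ : Measure X} [IsFiniteMeasure μ] {f : X → Y}
    {g : X → Z} (hfg : IndepFun f g μ) (hf : Measurable f) (hg : Measurable g) {t : Set Z}
    (ht : MeasurableSet t) (hμt : μ (g ⁻¹' t) ≠ 0) : (μ[|g ⁻¹' t]).map f = μ.map f := by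
  ext s hs
  rw [Measure.map_apply hf hs, Measure.map_apply hf hs, cond_apply (hg ht), Set.inter_comm,
    hfg.measure_inter_preimage_eq_mul _ _ hs ht, mul_comm, mul_assoc,
    ENNReal.mul_inv_cancel hμt (measure_ne_top μ _), mul_one]

theorem measure_cthickening_ne_zero [PseudoEMetricSpace X] [MeasurableSpace X] (μ : Measure X)
    [μ.IsOpenPosMeasure] {s : Set X} (hs : s.Nonempty) {ε : ℝ} (hε : 0 < ε) :
    μ (cthickening ε s) ≠ 0 := by
  refine ne_of_gt ((isOpen_thickening.measure_pos μ ?_).trans_le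
    (measure_mono (thickening_subset_cthickening ε s)))
  exact hs.mono (self_subset_thickening hε s)

theorem tendsto_probabilityMeasure_of_dist_le [PseudoMetricSpace X] [MeasurableSpace X]
    [OpensMeasurableSpace X] {ι : Type*} {l : Filter ι} [l.IsCountablyGenerated]
    {μ : ι → ProbabilityMeasure X} {ν : ProbabilityMeasure X} {ρ : X → X} (hρ : Measurable ρ)
    (hμρ : ∀ i, (μ i : Measure X).map ρ = ν) {r : ι → ℝ} (hr : Tendsto r l (𝓝 0))
    (hdist : ∀ i, ∀ᵐ x ∂(μ i : Measure X), dist x (ρ x) ≤ r i) : Tendsto μ l (𝓝 ν) := by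
  refine tendsto_iff_forall_lipschitz_integral_tendsto.2 ?_
  rintro f ⟨C, hC⟩ ⟨L, hL⟩
  let f' : X →ᵇ ℝ := ⟨⟨f, hL.continuous⟩, C, hC⟩
  have hf : Measurable f := hL.continuous.measurable
  have hint (m : Measure X) [IsFiniteMeasure m] : Integrable f m := f'.integrable m
  refine tendsto_iff_dist_tendsto_zero.2 (squeeze_zero (fun _ => dist_nonneg) (fun i => ?_)
    (by simpa only [mul_zero] using hr.const_mul (L : ℝ)))
  have hfρ : Integrable (fun x => f (ρ x)) (μ i : Measure X) :=
    (hint _).comp_measurable hρ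
  rw [← hμρ i, integral_map hρ.aemeasurable hf.aestronglyMeasurable, dist_eq_norm,
    ← integral_sub (hint _) hfρ]
  refine (norm_integral_le_of_norm_le_const ((hdist i).mono fun x hx => ?_)).trans_eq
    (by rw [probReal_univ, mul_one])
  rw [← dist_eq_norm]
  exact (hL.dist_le_mul x (ρ x)).trans (by gcongr)

variable {F : Type*} [NormedAddCommGroup F] [InnerProductSpace ℝ F] [FiniteDimensional ℝ F]
  [MeasurableSpace F] [BorelSpace F]

instance : (stdGaussian F).IsOpenPosMeasure := by
  have : (gaussianReal 0 1).IsOpenPosMeasure :=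
    (gaussianReal_absolutelyContinuous' 0 one_ne_zero).isOpenPosMeasure
  let e := (stdOrthonormalBasis ℝ F).repr.symm
  rw [← stdGaussian_map e, ← map_pi_eq_stdGaussian,
    Measure.map_map e.continuous.measurable (by fun_prop)]
  exact (e.continuous.comp (PiLp.continuous_toLp 2 _)).isOpenPosMeasure_map
    (e.surjective.comp (WithLp.toLp_surjective 2))

theorem indepFun_starProjection_stdGaussian {U W : Submodule ℝ F} (h : U ⟂ W) :
    IndepFun U.starProjection W.starProjection (stdGaussian F) := by
  have hid : HasGaussianLaw id (stdGaussian F) := ⟨by rw [Measure.map_id]; infer_instance⟩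
  have hpair : HasGaussianLaw (fun z => (U.starProjection z, W.starProjection z)) (stdGaussian F) :=
    hid.map_fun (U.starProjection.prod W.starProjection)
  refine hpair.indepFun_of_covariance_inner fun x y => ?_
  simp_rw [← Submodule.inner_starProjection_left_eq_right]
  rw [← covarianceBilin_apply_eq_cov IsGaussian.memLp_two_id, covarianceBilin_stdGaussian]
  exact h.inner_eq (U.starProjection_apply_mem x) (W.starProjection_apply_mem y)

variable (V : AffineSubspace ℝ F) [Nonempty V]

/-- The law of the orthogonal projection to `V` of a standard Gaussian vector. -/
def gaussianOn : Measure F :=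
  (stdGaussian F).map fun x => (EuclideanGeometry.orthogonalProjection V x : F)

instance : IsProbabilityMeasure (gaussianOn V) :=
  Measure.isProbabilityMeasure_map (continuous_orthogonalProjection_coe V).aemeasurable

variable {V}

/- The component of a Gaussian vector along `V` is independent of its component orthogonal to `V`,
and only the latter decides whether the vector lies in the thickening. -/
theorem map_orthogonalProjection_cond_cthickening {ε : ℝ} (hε : 0 < ε) :
    ((stdGaussian F)[|cthickening ε (V : Set F)]).map
      (fun x => (EuclideanGeometry.orthogonalProjection V x : F)) = gaussianOn V := by
  obtain ⟨v, hv⟩ := ‹Nonempty V›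
  have hindep := (indepFun_starProjection_stdGaussian V.direction.isOrtho_orthogonal_right).comp
    (measurable_add_const (V.directionᗮ.starProjection v)) measurable_id
  have hne := measure_cthickening_ne_zero (stdGaussian F) ⟨v, hv⟩ hε
  rw [gaussianOn]
  rw [cthickening_eq_starProjection_preimage hv hε.le] at hne ⊢
  simp_rw [orthogonalProjection_eq_add hv]
  exact map_cond_preimage_of_indepFun hindep (by fun_prop) (by fun_prop)
    isClosed_closedBall.measurableSet hne

theorem tendsto_integral_cond_cthickening (f : F →ᵇ ℝ) :
    Tendsto (fun ε : ℝ => ∫ x, f x ∂((stdGaussian F)[|cthickening ε (V : Set F)])) (𝓝[>] 0)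
      (𝓝 (∫ x, f x ∂(gaussianOn V))) := by
  have hprob (ε : Set.Ioi (0 : ℝ)) :
      IsProbabilityMeasure ((stdGaussian F)[|cthickening ε (V : Set F)]) :=
    cond_isProbabilityMeasure (measure_cthickening_ne_zero _ Set.Nonempty.of_subtype ε.2)
  let μ (ε : Set.Ioi (0 : ℝ)) : ProbabilityMeasure F := ⟨_, hprob ε⟩
  have hμ : Tendsto μ atBot (𝓝 ⟨gaussianOn V, inferInstance⟩) := by
    refine tendsto_probabilityMeasure_of_dist_le (continuous_orthogonalProjection_coe V).measurable
      (fun ε => map_orthogonalProjection_cond_cthickening ε.2) (r := Subtype.val) ?_ fun ε => ?_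
    · exact (tendsto_comp_coe_Ioi_atBot (f := id)).2 nhdsWithin_le_nhds
    · filter_upwards [ae_cond_mem isClosed_cthickening.measurableSet] with x hx
      exact (mem_cthickening_iff_dist_orthogonalProjection_le ε.2.le).1 hx
  rw [← tendsto_comp_coe_Ioi_atBot]
  exact ProbabilityMeasure.tendsto_iff_forall_integral_tendsto.1 hμ f

end Gaussian

section GaussianGiven

variable {d : ℕ}

theorem IsGaussianGiven.unique {V : AffineSubspace ℝ (E d)} {ν ν' : Measure (E d)}
    (h : IsGaussianGiven V ν) (h' : IsGaussianGiven V ν') : ν = ν' := by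
  have := h.1
  have := h'.1
  exact ext_of_forall_integral_eq_of_IsFiniteMeasure fun f =>
    tendsto_nhds_unique (h.2 f) (h'.2 f)

variable (V : AffineSubspace ℝ (E d)) [Nonempty V]

theorem isGaussianGiven_gaussianOn : IsGaussianGiven V (gaussianOn V) :=
  ⟨inferInstance, tendsto_integral_cond_cthickening⟩

theorem isGaussianGiven_gaussianGiven : IsGaussianGiven V (gaussianGiven V) := by
  have h : ∃ ν, IsGaussianGiven V ν := ⟨_, isGaussianGiven_gaussianOn V⟩
  rw [gaussianGiven, dif_pos h]
  exact h.choose_spec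

theorem gaussianGiven_eq_gaussianOn : gaussianGiven V = gaussianOn V :=
  (isGaussianGiven_gaussianGiven V).unique (isGaussianGiven_gaussianOn V)

end GaussianGiven

section FullSupport

theorem affineSpan_inter_of_mem_nhds {F : Type*} [AddCommGroup F] [Module ℝ F]
    [TopologicalSpace F] [IsTopologicalAddGroup F] [ContinuousSMul ℝ F] {B O : Set F}
    (hB : Convex ℝ B) {b : F} (hb : b ∈ B) (hO : O ∈ 𝓝 b) :
    affineSpan ℝ (B ∩ O) = affineSpan ℝ B := by
  refine le_antisymm (affineSpan_mono ℝ Set.inter_subset_left) (affineSpan_le.2 fun y hy => ?_)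
  have hlim : Tendsto (fun t : ℝ => AffineMap.lineMap b y t) (𝓝[>] 0) (𝓝 b) := by
    simpa only [AffineMap.lineMap_apply_zero] using
      ((AffineMap.lineMap_continuous (p := b) (q := y)).tendsto (0 : ℝ)).mono_left
        nhdsWithin_le_nhds
  obtain ⟨t, htO, ht0, ht1⟩ := ((hlim.eventually hO).and (Ioc_mem_nhdsGT zero_lt_one)).exists
  have hbO : b ∈ affineSpan ℝ (B ∩ O) := subset_affineSpan ℝ _ ⟨hb, mem_of_mem_nhds hO⟩
  have htB : AffineMap.lineMap b y t ∈ affineSpan ℝ (B ∩ O) :=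
    subset_affineSpan ℝ _ ⟨hB.lineMap_mem hb hy ⟨ht0.le, ht1⟩, htO⟩
  have hy_eq : AffineMap.lineMap b (AffineMap.lineMap b y t) t⁻¹ = y := by
    rw [AffineMap.lineMap_lineMap_right, inv_mul_cancel₀ ht0.ne', AffineMap.lineMap_apply_one]
  exact hy_eq ▸ AffineMap.lineMap_mem t⁻¹ hbO htB

variable {F : Type*} [NormedAddCommGroup F] [InnerProductSpace ℝ F] [FiniteDimensional ℝ F]
  [MeasurableSpace F] [BorelSpace F]

theorem gaussianOn_pos {C : Set F} (hC : Convex ℝ C) (hne : C.Nonempty)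
    {V : AffineSubspace ℝ F} [Nonempty V] (hCV : affineSpan ℝ C = V) : 0 < gaussianOn V C := by
  subst hCV
  obtain ⟨_, z, hz, rfl⟩ := hne.intrinsicInterior hC
  have hpos := (isOpen_interior.preimage
    (EuclideanGeometry.orthogonalProjection (affineSpan ℝ C)).continuous).measure_pos
    (stdGaussian F) ⟨z, by
      rwa [Set.mem_preimage, EuclideanGeometry.orthogonalProjection_mem_subspace_eq_self]⟩
  refine hpos.trans_le ((measure_mono ?_).trans
    (Measure.le_map_apply (continuous_orthogonalProjection_coe _).aemeasurable _))
  exact Set.preimage_mono interior_subset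

theorem gaussianOn_affineSpan_sdiff_pos {A B : Set F} (hA : IsClosed A) (hB : Convex ℝ B)
    [Nonempty (affineSpan ℝ B)] (hBA : (B \ A).Nonempty) :
    0 < gaussianOn (affineSpan ℝ B) (B \ A) := by
  obtain ⟨b, hbB, hbA⟩ := hBA
  obtain ⟨r, hr, hball⟩ := Metric.mem_nhds_iff.1 (hA.isOpen_compl.mem_nhds hbA)
  refine (gaussianOn_pos (hB.inter (convex_ball b r)) ⟨b, hbB, mem_ball_self hr⟩
    (affineSpan_inter_of_mem_nhds hB hbB (ball_mem_nhds b hr))).trans_le (measure_mono ?_)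
  exact Set.inter_subset_inter_right B hball

end FullSupport

/-! ### The map `φ` -/

section Dimension

variable {d : ℕ}

theorem affDim_bot : affDim (⊥ : AffineSubspace ℝ (E d)) = -1 :=
  if_pos (AffineSubspace.bot_coe ℝ (E d) (E d))

theorem affDim_of_nonempty {V : AffineSubspace ℝ (E d)} (hV : (V : Set (E d)).Nonempty) :
    affDim V = Module.finrank ℝ V.direction :=
  if_neg hV.ne_empty

theorem strictMono_affDim : StrictMono (affDim : AffineSubspace ℝ (E d) → ℤ) := by
  intro V W hVW
  have hW : (W : Set (E d)).Nonempty :=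
    (AffineSubspace.nonempty_iff_ne_bot W).2 (bot_le.trans_lt hVW).ne'
  rw [affDim_of_nonempty hW]
  rcases V.eq_bot_or_nonempty with rfl | hV
  · rw [affDim_bot]
    lia
  · rw [affDim_of_nonempty hV, Nat.cast_lt]
    exact Submodule.finrank_lt_finrank_of_lt (AffineSubspace.direction_lt_of_nonempty hVW hV)

theorem natCast_le_affDim_affineSpan_iff {A : Set (E d)} {k : ℕ} :
    (k : ℤ) ≤ affDim (affineSpan ℝ A) ↔
      ∃ y : Fin (k + 1) → E d, AffineIndependent ℝ y ∧ ∀ i, y i ∈ A := by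
  rcases A.eq_empty_or_nonempty with rfl | hA
  · rw [AffineSubspace.span_empty, affDim_bot]
    refine iff_of_false (by lia) ?_
    rintro ⟨y, -, hy⟩
    exact hy 0
  rw [affDim_of_nonempty ((affineSpan_nonempty ℝ).2 hA), Nat.cast_le]
  constructor
  · intro hk
    obtain ⟨t, htA, hspan, hind⟩ := exists_affineIndependent ℝ (E d) A
    have := (finite_set_of_fin_dim_affineIndependent ℝ hind).fintype
    have : Nonempty t := by
      rwa [Set.nonempty_coe_sort, ← affineSpan_nonempty ℝ, hspan, affineSpan_nonempty]
    have hcard := hind.finrank_vectorSpan_add_one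
    rw [Subtype.range_coe, ← direction_affineSpan, hspan] at hcard
    obtain ⟨e⟩ : Nonempty (Fin (k + 1) ↪ t) := by
      apply Function.Embedding.nonempty_of_card_le
      rw [Fintype.card_fin]
      exact (Nat.add_le_add_right hk 1).trans hcard.le
    exact ⟨fun i => e i, hind.comp_embedding e, fun i => htA (e i).2⟩
  · rintro ⟨y, hy, hyA⟩
    rw [direction_affineSpan, ← hy.finrank_vectorSpan (Fintype.card_fin _)]
    exact Submodule.finrank_mono (vectorSpan_mono ℝ (Set.range_subset_iff.2 hyA))

theorem measurable_affDim_affineSpan {T : Type*} [MeasurableSpace T]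
    {B : T → Set (E d)} (hB : WeaklyMeasurable B) :
    Measurable fun t => affDim (affineSpan ℝ (B t)) := by
  refine measurable_of_Ici fun k => ?_
  rcases le_or_gt k (-1) with hk | hk
  · convert MeasurableSet.univ
    ext t
    have hbot := strictMono_affDim.monotone (bot_le (a := affineSpan ℝ (B t)))
    rw [affDim_bot] at hbot
    exact iff_of_true (hk.trans hbot) trivial
  · lift k to ℕ using by lia
    convert (WeaklyMeasurable.pi fun _ : Fin (k + 1) => hB)
      (isOpen_setOfPred_affineIndependent (𝕜 := ℝ) (ι := Fin (k + 1))) using 1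
    ext t
    refine natCast_le_affDim_affineSpan_iff.trans (exists_congr fun y => ?_)
    rw [Set.mem_inter_iff, Set.mem_univ_pi, and_comm]
    rfl

end Dimension

section Phi

variable {d : ℕ}

theorem gaussianGiven_affineSpan_apply (A : CO d) :
    gaussianGiven (affineSpan ℝ A.carrier) A.carrier = stdGaussian (E d)
      {x | infEDist x A.carrier ≠ ⊤ ∧
        infEDist x A.carrier ≤ infEDist x (affineSpan ℝ A.carrier : Set (E d))} := by
  rcases A.carrier.eq_empty_or_nonempty with hA | hA
  · simp only [hA, measure_empty, infEDist_empty, ne_eq, not_true_eq_false, false_and,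
      Set.ofPred_false]
  have hV := (affineSpan_nonempty ℝ).2 hA
  have := hV.to_subtype
  rw [gaussianGiven_eq_gaussianOn, gaussianOn, Measure.map_apply
    (continuous_orthogonalProjection_coe _).measurable A.isClosed.measurableSet]
  congr 1
  ext x
  rw [Set.mem_preimage,
    orthogonalProjection_mem_iff_infDist_le A.isClosed hA (subset_affineSpan ℝ _), infDist, infDist,
    ENNReal.toReal_le_toReal (infEDist_ne_top hA) (infEDist_ne_top hV)]
  exact (and_iff_right (infEDist_ne_top hA)).symm

theorem measurable_phi : Measurable (phi : CO d → ℝ) := by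
  have hcar := CO.weaklyMeasurable_carrier (d := d)
  have hdist := hcar.measurable_infEDist_prod
  refine .add ((measurable_of_countable Int.cast).comp (measurable_affDim_affineSpan hcar)) ?_
  simp only [measureReal_def, gaussianGiven_affineSpan_apply]
  exact (measurable_measure_prodMk_left (.inter (hdist (measurableSet_singleton ⊤).compl)
    (measurableSet_le hdist hcar.affineSpan.measurable_infEDist_prod))).ennreal_toReal

theorem affDim_lt_phi {A : CO d} (hA : A.carrier.Nonempty) :
    affDim (affineSpan ℝ A.carrier) < phi A := by
  have := ((affineSpan_nonempty ℝ).2 hA).to_subtype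
  rw [phi, lt_add_iff_pos_right, gaussianGiven_eq_gaussianOn]
  exact ENNReal.toReal_pos (gaussianOn_pos A.convex hA rfl).ne' (by finiteness)

theorem phi_le_affDim_add_one (A : CO d) : phi A ≤ affDim (affineSpan ℝ A.carrier) + 1 := by
  rw [phi, measureReal_def, gaussianGiven_affineSpan_apply]
  gcongr
  exact measureReal_le_one

theorem strictMono_phi : StrictMono (phi : CO d → ℝ) := by
  intro A B hAB
  have hle : A.carrier ⊆ B.carrier := hAB.le
  have hdiff : (B.carrier \ A.carrier).Nonempty := Set.sdiff_nonempty.2 hAB.not_ge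
  have hB : B.carrier.Nonempty := hdiff.mono Set.sdiff_subset
  rcases (affineSpan_mono ℝ hle).eq_or_lt with hspan | hspan
  · have := ((affineSpan_nonempty ℝ).2 hB).to_subtype
    have hpos : 0 < (gaussianOn (affineSpan ℝ B.carrier)).real (B.carrier \ A.carrier) :=
      ENNReal.toReal_pos (gaussianOn_affineSpan_sdiff_pos A.isClosed B.convex hdiff).ne'
        (by finiteness)
    rw [measureReal_sdiff hle A.isClosed.measurableSet, sub_pos] at hpos
    rw [phi, phi, hspan, gaussianGiven_eq_gaussianOn]
    gcongr
  · calc phi A ≤ affDim (affineSpan ℝ A.carrier) + 1 := phi_le_affDim_add_one A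
      _ ≤ affDim (affineSpan ℝ B.carrier) := by exact_mod_cast strictMono_affDim hspan
      _ < phi B := affDim_lt_phi hB

end Phi

end ConvexLattice

end

theorem theoremT (d : ℕ) :
    (ConvexLattice.A1 (ConvexLattice.CO d) ∧
      ConvexLattice.A2 (ConvexLattice.CO d) ∧
      ConvexLattice.A3 (ConvexLattice.CO d)) ∧
    (∀ V : AffineSubspace ℝ (ConvexLattice.E d), (V : Set (ConvexLattice.E d)).Nonempty →
      ConvexLattice.IsGaussianGiven V (ConvexLattice.gaussianGiven V)) ∧
    StrictMono (ConvexLattice.phi : ConvexLattice.CO d → ℝ) ∧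
    Measurable (ConvexLattice.phi : ConvexLattice.CO d → ℝ) := by
  refine ⟨⟨ConvexLattice.CO.measurableSet_le,
    ⟨ConvexLattice.CO.measurable_iSup, ConvexLattice.CO.measurable_iInf⟩,
    ConvexLattice.phi, ConvexLattice.strictMono_phi, ConvexLattice.measurable_phi⟩, ?_,
    ConvexLattice.strictMono_phi, ConvexLattice.measurable_phi⟩
  intro V hV
  have := hV.to_subtype
  exact ConvexLattice.isGaussianGiven_gaussianGiven V
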